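/- Let $\mathbb D=\{z\in\mathbb C:|z|<1\}$ and let $\mathcal K$ be the class of functions $f$ that are analytic in $\mathbb D$, normalized by $f(0)=0$ and $f'(0)=1$, and map $\mathbb D$ one-to-one onto a convex domain. For $f\in\mathcal K$ let the logarithmic coefficients $\gamma_n$, $n\ge 1$, be defined by $$\log\frac{f(z)}{z}=2\sum_{n=1}^{\infty}\gamma_n z^n ,$$ where the branch of the logarithm is the one that vanishes at $z=0$. **Theorem.** For every $f\in\mathcal K$, $$-\frac1{\sqrt{10}}\le|\gamma_2|-|\gamma_1|\le\frac16 .$$ The upper bound is sharp: the function $$f_0(z)=\int_0^z\frac{dt}{1-t^2}=\operatorname{artanh} z=\frac12\operatorname{Log}\frac{1+z}{1-z}\qquad(z\in\mathbb D)$$ belongs to $\mathcal K$, and for it $|\gamma_2|-|\gamma_1|=\frac16$. -/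

import Mathlib

/-- The class of functions that are analytic in the open unit disk, normalized by
`f(z) = z + a₂ z² + a₃ z³ + ⋯`. The values outside the disk play no role. -/
structure IsNormalizedAnalytic (f : ℂ → ℂ) : Prop where
  differentiableOn : DifferentiableOn ℂ f (Metric.ball 0 1)
  map_zero : f 0 = 0
  deriv_zero : deriv f 0 = 1

/-- The class of (normalized) convex univalent functions: normalized analytic functions that map
the open unit disk one-to-one onto a convex domain. -/
structure IsConvexUnivalent (f : ℂ → ℂ) : Prop extends IsNormalizedAnalytic f where
  injOn : Set.InjOn f (Metric.ball 0 1)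
  convex_image : Convex ℝ (f '' Metric.ball 0 1)

/-- The logarithmic coefficients `γₙ` of `f`, given by `log (f(z) / z) = 2 ∑_{n ≥ 1} γₙ zⁿ`:
half of the `n`-th Taylor coefficient at `0` of `log (f(z) / z)`.
Here `dslope f 0 z` is `f(z) / z` with its removable singularity at `0` filled in by `f'(0)`
(when `f(0) = 0`); for a normalized `f` its value at `0` is `1`, so the principal logarithm is
near `0` the analytic branch that vanishes at `0`. -/
noncomputable def logCoeff (f : ℂ → ℂ) (n : ℕ) : ℂ :=
  iteratedDeriv n (fun z => Complex.log (dslope f 0 z)) 0 / (n.factorial : ℂ) / 2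

/-- The function `f₀(z) = ∫₀^z dt / (1 - t²)`, the integral being taken along the segment
`t = s z`, `0 ≤ s ≤ 1`. -/
noncomputable def convexExtremal (z : ℂ) : ℂ :=
  ∫ s in (0 : ℝ)..1, z / (1 - ((s : ℂ) * z) ^ 2)

open Metric Set Filter Topology

/-! Put `a = a₂`, `d = 3 (a₃ - a₂²)`, `t = ‖a‖`. Then `γ₁ = a / 2` and `γ₂ = d / 6 + a² / 4`, so
everything rests on Trimble's inequality `‖d‖ ≤ 1 - t²` (`norm_coeff_le`). The upper bound is `1/6 +
t²/12 - t/2 ≤ 1/6` on `[0, 1]`; the lower one follows from `‖γ₂‖ ≥ max 0 ((5t² - 2)/12)`, whose two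
branches meet at `t = 2/√10`.

Trimble's inequality is Schwarz–Pick for `ψ = f'' / (2f' + z f'')`, where `ψ 0 = a` and `ψ' 0 = d`.
That `ψ` is bounded by `1` comes from `Re (1 + z f''/f') ≥ 0` (`re_one_add_nonneg`), obtained from
convexity of the image by applying the Schwarz lemma to midpoints. Equality at `1/6` occurs for
`artanh`, where `a = 0` and `d = 1`. -/

/-! ### Univalent functions and their inverses. -/

/-- An injective holomorphic function has open image on an open set, locally around each point. -/
theorem nhds_le_map_nhds_of_injOn {f : ℂ → ℂ} {U : Set ℂ} (hU : IsOpen U)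
    (hf : DifferentiableOn ℂ f U) (hinj : InjOn f U) {z : ℂ} (hz : z ∈ U) :
    𝓝 (f z) ≤ map f (𝓝 z) := by
  refine (hf.analyticAt (hU.mem_nhds hz)).eventually_constant_or_nhds_le_map_nhds.resolve_left
    fun h => ?_
  have h1 : ∀ᶠ w in 𝓝 z, w = z := by
    filter_upwards [h, hU.mem_nhds hz] with w hw hwU using hinj hwU hz hw
  have h2 : ∀ᶠ w in 𝓝[≠] z, w = z := h1.filter_mono nhdsWithin_le_nhds
  obtain ⟨w, hw, hw'⟩ := (h2.and self_mem_nhdsWithin).exists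
  exact hw' hw

theorem isOpen_image_of_injOn {f : ℂ → ℂ} {U : Set ℂ} (hU : IsOpen U)
    (hf : DifferentiableOn ℂ f U) (hinj : InjOn f U) : IsOpen (f '' U) := by
  rw [isOpen_iff_mem_nhds]
  rintro _ ⟨z, hz, rfl⟩
  exact nhds_le_map_nhds_of_injOn hU hf hinj hz (image_mem_map (hU.mem_nhds hz))

theorem continuousAt_invFunOn_of_injOn {f : ℂ → ℂ} {U : Set ℂ} (hU : IsOpen U)
    (hf : DifferentiableOn ℂ f U) (hinj : InjOn f U) {z : ℂ} (hz : z ∈ U) :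
    ContinuousAt (Function.invFunOn f U) (f z) := by
  have h : Tendsto (Function.invFunOn f U) (map f (𝓝 z)) (𝓝 z) := by
    rw [tendsto_map'_iff]
    refine tendsto_id.congr' ?_
    filter_upwards [hU.mem_nhds hz] with w hw using (hinj.leftInvOn_invFunOn hw).symm
  have := h.mono_left (nhds_le_map_nhds_of_injOn hU hf hinj hz)
  rwa [ContinuousAt, hinj.leftInvOn_invFunOn hz]

theorem hasDerivAt_invFunOn_of_injOn {f : ℂ → ℂ} {U : Set ℂ} (hU : IsOpen U)
    (hf : DifferentiableOn ℂ f U) (hinj : InjOn f U) {z : ℂ} (hz : z ∈ U) (h0 : deriv f z ≠ 0) :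
    HasDerivAt (Function.invFunOn f U) (deriv f z)⁻¹ (f z) := by
  refine HasDerivAt.of_local_left_inverse (f := f)
    (continuousAt_invFunOn_of_injOn hU hf hinj hz) ?_ h0 ?_
  · rw [hinj.leftInvOn_invFunOn hz]
    exact (hf.differentiableAt (hU.mem_nhds hz)).hasDerivAt
  · filter_upwards [(isOpen_image_of_injOn hU hf hinj).mem_nhds (mem_image_of_mem f hz)] with w hw
      using Function.invFunOn_eq hw

/-- The derivative of an injective holomorphic function has no zeros. -/
theorem deriv_ne_zero_of_injOn {f : ℂ → ℂ} {U : Set ℂ} (hU : IsOpen U)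
    (hf : DifferentiableOn ℂ f U) (hinj : InjOn f U) {z : ℂ} (hz : z ∈ U) : deriv f z ≠ 0 := by
  intro h0
  have han := hf.analyticAt (hU.mem_nhds hz)
  have hdiff := hf.differentiableAt (hU.mem_nhds hz)
  rcases han.deriv.eventually_eq_zero_or_eventually_ne_zero with h | h
  · obtain ⟨r, hr, hball⟩ := Metric.eventually_nhds_iff_ball.1 (h.and (hU.mem_nhds hz))
    have hne : ∀ᶠ w in 𝓝[≠] z, w ∈ ball z r :=
      nhdsWithin_le_nhds (ball_mem_nhds z hr)
    obtain ⟨w, hw, hw'⟩ := (hne.and self_mem_nhdsWithin).exists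
    have : f w = f z := isOpen_ball.is_const_of_deriv_eq_zero (convex_ball z r).isPreconnected
      (hf.mono fun x hx => (hball x hx).2) (fun x hx => (hball x hx).1) hw (mem_ball_self hr)
    exact hw' (hinj (hball w hw).2 hz this)
  -- Zeros of `f'` are isolated here, so the continuous inverse is holomorphic on a punctured
  -- neighbourhood of `f z`. The singularity is removable, and the chain rule for `g ∘ f = id`
  -- forbids `f' z = 0`.
  · set g := Function.invFunOn f U with hg
    have hgan : AnalyticAt ℂ g (f z) := by
      refine Complex.analyticAt_of_differentiable_on_punctured_nhds_of_continuousAt ?_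
        (continuousAt_invFunOn_of_injOn hU hf hinj hz)
      rw [eventually_nhdsWithin_iff] at h ⊢
      have := nhds_le_map_nhds_of_injOn hU hf hinj hz
      refine this ?_
      rw [← Filter.Eventually, eventually_map]
      filter_upwards [h, hU.mem_nhds hz] with w hw hwU hne
      exact (hasDerivAt_invFunOn_of_injOn hU hf hinj hwU
        (hw fun e => hne (by rw [mem_singleton_iff.1 e]; rfl))).differentiableAt
    have h1 : HasDerivAt (g ∘ f) (deriv g (f z) * deriv f z) z :=
      hgan.differentiableAt.hasDerivAt.comp z hdiff.hasDerivAt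
    have h2 : HasDerivAt (g ∘ f) 1 z := by
      refine (hasDerivAt_id z).congr_of_eventuallyEq ?_
      filter_upwards [hU.mem_nhds hz] with w hw using hinj.leftInvOn_invFunOn hw
    have := h1.unique h2
    simp [h0] at this

/-! ### Taylor coefficients through divided slopes, and logarithmic coefficients. -/

theorem sub_sq_mul_dslope_dslope (K : ℂ → ℂ) (z : ℂ) :
    K z = K 0 + z * deriv K 0 + z ^ 2 * dslope (dslope K 0) 0 z := by
  have h1 := sub_smul_dslope K 0 z
  have h2 := sub_smul_dslope (dslope K 0) 0 z
  simp only [sub_zero, smul_eq_mul, dslope_same] at h1 h2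
  linear_combination -h1 - z * h2

theorem analyticAt_dslope_zero {f : ℂ → ℂ} (hf : AnalyticAt ℂ f 0) :
    AnalyticAt ℂ (dslope f 0) 0 := by
  obtain ⟨s, hs, hd⟩ : ∃ s ∈ 𝓝 (0 : ℂ), DifferentiableOn ℂ f s :=
    ⟨_, hf.eventually_analyticAt, fun z hz => hz.differentiableAt.differentiableWithinAt⟩
  exact ((Complex.differentiableOn_dslope hs).2 hd).analyticAt hs

/-- The first two Taylor coefficients of `f(z) / z` in terms of those of `f`. -/
theorem deriv_dslope_zero {f : ℂ → ℂ} (hf : AnalyticAt ℂ f 0) (h0 : f 0 = 0) :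
    deriv (deriv f) 0 = 2 * deriv (dslope f 0) 0 ∧
      deriv (deriv (deriv f)) 0 = 3 * deriv (deriv (dslope f 0)) 0 := by
  have hg := analyticAt_dslope_zero hf
  set g := dslope f 0 with hgdef
  have e0 : f = fun z => z * g z := by
    ext z
    have := sub_smul_dslope f 0 z
    simpa [h0] using this.symm
  have e1 : deriv f =ᶠ[𝓝 0] fun z => g z + z * deriv g z := by
    filter_upwards [hg.eventually_analyticAt] with z hz
    rw [e0]
    simpa using ((hasDerivAt_id' z).fun_mul hz.differentiableAt.hasDerivAt).deriv
  have e2 : deriv (deriv f) =ᶠ[𝓝 0] fun z => 2 * deriv g z + z * deriv (deriv g) z := by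
    filter_upwards [e1.eventuallyEq_nhds, hg.eventually_analyticAt] with z hz hz'
    rw [hz.deriv_eq]
    have := (hz'.differentiableAt.hasDerivAt.add
      ((hasDerivAt_id z).mul hz'.deriv.differentiableAt.hasDerivAt)).deriv
    refine this.trans ?_
    simp; ring
  have e3 : deriv (deriv (deriv f)) 0 = 3 * deriv (deriv g) 0 := by
    rw [e2.deriv_eq]
    refine ((hg.deriv.differentiableAt.hasDerivAt.const_mul 2).add
      ((hasDerivAt_id (0 : ℂ)).mul hg.deriv.deriv.differentiableAt.hasDerivAt)).deriv.trans ?_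
    simp; ring
  exact ⟨by simpa using e2.self_of_nhds, e3⟩

theorem dslope_dslope_zero {K : ℂ → ℂ} (hK : AnalyticAt ℂ K 0) :
    dslope (dslope K 0) 0 0 = deriv (deriv K) 0 / 2 := by
  have h := (deriv_dslope_zero (f := fun z => K z - K 0) (hK.sub analyticAt_const) (by simp)).1
  have e : dslope (fun z => K z - K 0) 0 = dslope K 0 := by
    ext z
    rcases eq_or_ne z 0 with rfl | hz
    · simp [deriv_sub_const]
    · simp [dslope_of_ne _ hz, slope_def_field]
  have e' : deriv (fun z => K z - K 0) = deriv K := by ext z; simp [deriv_sub_const]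
  rw [e, e'] at h
  rw [dslope_same, h]; ring

/-- The first two logarithmic coefficients in terms of the Taylor coefficients. -/
theorem logCoeff_one_two {f : ℂ → ℂ} (hf : AnalyticAt ℂ f 0) (h0 : f 0 = 0)
    (h1 : deriv f 0 = 1) :
    logCoeff f 1 = deriv (deriv f) 0 / 4 ∧
      logCoeff f 2 = (deriv (deriv (deriv f)) 0 / 6 - (deriv (deriv f) 0 / 2) ^ 2 / 2) / 2 := by
  have hg := analyticAt_dslope_zero hf
  obtain ⟨d2, d3⟩ := deriv_dslope_zero hf h0
  have hg0 : dslope f 0 0 = 1 := by rw [dslope_same, h1]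
  set g := dslope f 0 with hgdef
  have hslit : ∀ᶠ z in 𝓝 (0 : ℂ), g z ∈ Complex.slitPlane :=
    hg.continuousAt.eventually_mem
      (Complex.isOpen_slitPlane.mem_nhds (by rw [hg0]; exact Complex.one_mem_slitPlane))
  have e1 : deriv (fun z => Complex.log (g z)) =ᶠ[𝓝 0] fun z => deriv g z / g z := by
    filter_upwards [hslit, hg.eventually_analyticAt] with z hz hz'
    exact (hz'.differentiableAt.hasDerivAt.clog hz).deriv
  have e2 : deriv (deriv (fun z => Complex.log (g z))) 0 = deriv (deriv g) 0 - deriv g 0 ^ 2 := by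
    rw [e1.deriv_eq]
    refine (hg.deriv.differentiableAt.hasDerivAt.fun_div hg.differentiableAt.hasDerivAt
      (by simp [hg0])).deriv.trans ?_
    rw [hg0]; ring
  have e1' := e1.self_of_nhds
  simp only [hg0, div_one] at e1'
  constructor
  · rw [logCoeff, iteratedDeriv_one, e1', d2]; simp; ring
  · rw [logCoeff, iteratedDeriv_succ, iteratedDeriv_one, e2, d2, d3]
    simp [Nat.factorial]; ring

/-! ### Schwarz–Pick. -/

/-- The **Schwarz–Pick inequality** at the centre of the unit disk. -/
theorem norm_deriv_zero_le_one_sub_sq {φ : ℂ → ℂ} (hd : DifferentiableOn ℂ φ (ball 0 1))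
    (hφ : MapsTo φ (ball 0 1) (closedBall 0 1)) : ‖deriv φ 0‖ ≤ 1 - ‖φ 0‖ ^ 2 := by
  have h0 : (0 : ℂ) ∈ ball (0 : ℂ) 1 := mem_ball_self one_pos
  have hn : ∀ z ∈ ball (0 : ℂ) 1, ‖φ z‖ ≤ 1 := fun z hz => by simpa using hφ hz
  rcases (hn 0 h0).eq_or_lt with h | h
  -- By the maximum principle `φ` is locally constant, and both sides vanish.
  · have hmax : IsLocalMax (norm ∘ φ) 0 := by
      filter_upwards [ball_mem_nhds (0 : ℂ) one_pos] with z hz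
      simpa [h] using hn z hz
    have hev : ∀ᶠ z in 𝓝 (0 : ℂ), DifferentiableAt ℂ φ z := by
      filter_upwards [isOpen_ball.mem_nhds h0] with z hz
        using hd.differentiableAt (isOpen_ball.mem_nhds hz)
    have hc : φ =ᶠ[𝓝 0] fun _ => φ 0 := Complex.eventually_eq_of_isLocalMax_norm hev hmax
    rw [hc.deriv_eq, h]; simp
  · set a := φ 0 with ha
    have hden : ∀ z ∈ ball (0 : ℂ) 1, 1 - (starRingEnd ℂ) a * φ z ≠ 0 := by
      intro z hz he
      have h1 : ‖(starRingEnd ℂ) a * φ z‖ = 1 := by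
        rw [← sub_eq_zero.1 he]; simp
      rw [norm_mul, Complex.norm_conj] at h1
      nlinarith [hn z hz, norm_nonneg (φ z), norm_nonneg a]
    set χ : ℂ → ℂ := fun z => (φ z - a) / (1 - (starRingEnd ℂ) a * φ z) with hχ
    have hχd : DifferentiableOn ℂ χ (ball 0 1) :=
      (hd.sub_const a).div ((hd.const_mul _).const_sub 1) hden
    have hχ0 : χ 0 = 0 := by simp [hχ, ha]
    have hmaps : MapsTo χ (ball 0 1) (closedBall (χ 0) 1) := by
      intro z hz
      rw [hχ0, mem_closedBall_zero_iff, norm_div,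
        div_le_one (norm_pos_iff.2 (hden z hz))]
      rw [← sq_le_sq₀ (norm_nonneg _) (norm_nonneg _), ← Complex.normSq_eq_norm_sq,
        ← Complex.normSq_eq_norm_sq]
      have hz1 : Complex.normSq (φ z) ≤ 1 := by
        rw [Complex.normSq_eq_norm_sq]; nlinarith [hn z hz, norm_nonneg (φ z)]
      have ha1 : Complex.normSq a ≤ 1 := by
        rw [Complex.normSq_eq_norm_sq]; nlinarith [h, norm_nonneg a]
      simp only [Complex.normSq_apply, Complex.sub_re, Complex.sub_im, Complex.mul_re,
        Complex.mul_im, Complex.conj_re, Complex.conj_im, Complex.one_re, Complex.one_im]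
        at hz1 ha1 ⊢
      -- `|1 - āφ|² - |φ - a|² = (1 - |φ|²)(1 - |a|²)`.
      nlinarith [mul_nonneg (sub_nonneg.2 hz1) (sub_nonneg.2 ha1)]
    have hle := Complex.norm_deriv_le_one_of_mapsTo_ball hχd hmaps one_pos
    have hφ0 := (hd.differentiableAt (isOpen_ball.mem_nhds h0)).hasDerivAt
    have hder : deriv χ 0 = deriv φ 0 / (1 - (starRingEnd ℂ) a * a) := by
      refine ((hφ0.sub_const a).fun_div ((hφ0.const_mul _).const_sub 1)
        (hden 0 h0)).deriv.trans ?_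
      have := hden 0 h0
      rw [← ha] at this ⊢
      field_simp
      ring
    have hpos : 0 < 1 - ‖a‖ ^ 2 := by nlinarith [norm_nonneg a]
    have hc : (1 : ℂ) - (starRingEnd ℂ) a * a = ((1 - ‖a‖ ^ 2 : ℝ) : ℂ) := by
      rw [mul_comm, Complex.mul_conj, Complex.normSq_eq_norm_sq]; push_cast; ring
    rwa [hder, hc, norm_div, Complex.norm_real, Real.norm_of_nonneg hpos.le,
      div_le_one hpos] at hle

/-! ### Convex functions: analytic characterization and coefficient bounds. -/

namespace IsConvexUnivalent

variable {f : ℂ → ℂ}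

theorem deriv_ne_zero (hf : IsConvexUnivalent f) {z : ℂ} (hz : z ∈ ball (0 : ℂ) 1) :
    deriv f z ≠ 0 :=
  deriv_ne_zero_of_injOn isOpen_ball hf.differentiableOn hf.injOn hz

/-- Convexity keeps the midpoint in the image, so `w ↦ f⁻¹((f(aw) + f(bw)) / 2)` is a holomorphic
self-map of the disk fixing `0`, and the Schwarz lemma applies. -/
theorem norm_invFunOn_le (hf : IsConvexUnivalent f) {z a b : ℂ} (hz : z ∈ ball (0 : ℂ) 1)
    (ha : ‖a‖ = 1) (hb : ‖b‖ = 1) :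
    (f (a * z) + f (b * z)) / 2 ∈ f '' ball 0 1 ∧
      ‖Function.invFunOn f (ball 0 1) ((f (a * z) + f (b * z)) / 2)‖ ≤ ‖z‖ := by
  have hmul : ∀ c : ℂ, ‖c‖ = 1 → MapsTo (fun w => c * w) (ball (0 : ℂ) 1) (ball 0 1) := by
    intro c hc w hw
    simpa [hc] using hw
  have hmem : ∀ w ∈ ball (0 : ℂ) 1, (f (a * w) + f (b * w)) / 2 ∈ f '' ball 0 1 := by
    intro w hw
    have := hf.convex_image (mem_image_of_mem f (hmul a ha hw)) (mem_image_of_mem f (hmul b hb hw))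
      (by norm_num : (0 : ℝ) ≤ 1 / 2) (by norm_num : (0 : ℝ) ≤ 1 / 2) (by norm_num)
    convert this using 1
    simp only [Complex.real_smul]; push_cast; ring
  refine ⟨hmem z hz, ?_⟩
  have hinv : DifferentiableOn ℂ (Function.invFunOn f (ball 0 1)) (f '' ball 0 1) := by
    rintro _ ⟨w, hw, rfl⟩
    exact (hasDerivAt_invFunOn_of_injOn isOpen_ball hf.differentiableOn hf.injOn hw
      (hf.deriv_ne_zero hw)).differentiableAt.differentiableWithinAt
  have hmean : DifferentiableOn ℂ (fun w => (f (a * w) + f (b * w)) / 2) (ball 0 1) :=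
    ((hf.differentiableOn.fun_comp (differentiableOn_id.const_mul a) (hmul a ha)).fun_add
      (hf.differentiableOn.fun_comp (differentiableOn_id.const_mul b) (hmul b hb))).div_const 2
  refine Complex.norm_le_norm_of_mapsTo_ball (R := 1)
    (f := fun w => Function.invFunOn f (ball 0 1) ((f (a * w) + f (b * w)) / 2))
    (hinv.fun_comp hmean hmem)
    (fun w hw => ball_subset_closedBall (Function.invFunOn_mem (hmem w hw))) ?_ (by simpa using hz)
  have := hf.injOn.leftInvOn_invFunOn (mem_ball_self one_pos : (0 : ℂ) ∈ ball (0 : ℂ) 1)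
  rw [hf.map_zero] at this
  simpa [hf.map_zero] using this

/-- The analytic characterization of convexity: `Re (1 + z f''(z) / f'(z)) ≥ 0`. -/
theorem re_one_add_nonneg (hf : IsConvexUnivalent f) {z : ℂ} (hz : z ∈ ball (0 : ℂ) 1) :
    0 ≤ (1 + z * deriv (deriv f) z / deriv f z).re := by
  rcases eq_or_ne z 0 with rfl | hz0
  · simp
  have hUz := isOpen_ball.mem_nhds hz
  have han : AnalyticAt ℂ f z := hf.differentiableOn.analyticAt hUz
  have hf' := hf.deriv_ne_zero hz
  set g := Function.invFunOn f (ball (0 : ℂ) 1) with hgdef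
  have hg : HasDerivAt g (deriv f z)⁻¹ (f z) :=
    hasDerivAt_invFunOn_of_injOn isOpen_ball hf.differentiableOn hf.injOn hz hf'
  have hgz : g (f z) = z := hf.injOn.leftInvOn_invFunOn hz
  -- the function `f` along the circle through `z`
  set K : ℂ → ℂ := fun τ => f (Complex.exp τ * z) with hKdef
  have hK0 : K 0 = f z := by simp [hKdef]
  have harg : AnalyticAt ℂ (fun τ => Complex.exp τ * z) 0 := by fun_prop
  have hKan : AnalyticAt ℂ K 0 := AnalyticAt.fun_comp (by simpa using han) harg
  have hexp : ∀ τ, HasDerivAt (fun τ => Complex.exp τ * z) (Complex.exp τ * z) τ :=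
    fun τ => (Complex.hasDerivAt_exp τ).mul_const z
  have hev : ∀ᶠ τ in 𝓝 (0 : ℂ), AnalyticAt ℂ f (Complex.exp τ * z) :=
    harg.continuousAt.eventually (by simpa using han.eventually_analyticAt)
  have hK1 : deriv K =ᶠ[𝓝 0] fun τ => deriv f (Complex.exp τ * z) * (Complex.exp τ * z) := by
    filter_upwards [hev] with τ hτ
    exact (hτ.differentiableAt.hasDerivAt.comp τ (hexp τ)).deriv
  have hK2 : deriv (deriv K) 0 = deriv (deriv f) z * z * z + deriv f z * z := by
    rw [hK1.deriv_eq]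
    have h2 := han.deriv.differentiableAt.hasDerivAt
    have h3 : HasDerivAt (fun τ => deriv f (Complex.exp τ * z)) (deriv (deriv f) z * z) 0 := by
      have := HasDerivAt.comp (h₂ := deriv f) (h := fun τ => Complex.exp τ * z) (0 : ℂ)
        (by rwa [Complex.exp_zero, one_mul]) (hexp 0)
      rw [Complex.exp_zero, one_mul] at this
      exact this
    simpa using (h3.fun_mul (hexp 0)).deriv
  set D := dslope (dslope K 0) 0 with hDdef
  have hD0 : D 0 = (deriv (deriv f) z * z * z + deriv f z * z) / 2 := by
    rw [hDdef, dslope_dslope_zero hKan, hK2]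
  have hDc : ContinuousAt D 0 :=
    (analyticAt_dslope_zero (analyticAt_dslope_zero hKan)).continuousAt
  set Q : ℝ → ℂ := fun t => (D (t * Complex.I) + D (-(t * Complex.I))) / 2 with hQdef
  set F : ℝ → ℂ := fun t => (K (t * Complex.I) + K (-(t * Complex.I))) / 2 with hFdef
  have hti : Tendsto (fun t : ℝ => (t : ℂ) * Complex.I) (𝓝 0) (𝓝 0) := by
    have : Continuous (fun t : ℝ => (t : ℂ) * Complex.I) := by fun_prop
    simpa using this.tendsto 0
  have hti' : Tendsto (fun t : ℝ => -((t : ℂ) * Complex.I)) (𝓝 0) (𝓝 0) := by simpa using hti.neg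
  have hQ : Tendsto Q (𝓝 0) (𝓝 (D 0)) := by
    have := ((hDc.tendsto.comp hti).add (hDc.tendsto.comp hti')).div_const 2
    simpa using this
  have hF : Tendsto F (𝓝 0) (𝓝 (f z)) := by
    have hKc := hKan.continuousAt.tendsto
    rw [hK0] at hKc
    have := ((hKc.comp hti).add (hKc.comp hti')).div_const 2
    simpa using this
  -- Averaging over `±it` cancels the first-order term, leaving the second derivative along the
  -- circle.
  have hFQ : ∀ t, F t - f z = -(t : ℂ) ^ 2 * Q t := by
    intro t
    have h1 := sub_sq_mul_dslope_dslope K (t * Complex.I)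
    have h2 := sub_sq_mul_dslope_dslope K (-(t * Complex.I))
    simp only [hFdef, hQdef, ← hK0]
    rw [h1, h2, ← hDdef]
    linear_combination (t : ℂ) ^ 2 * (D (t * Complex.I) + D (-(t * Complex.I))) / 2 *
      Complex.I_sq
  have hgc : Tendsto (fun t => dslope g (f z) (F t)) (𝓝 0) (𝓝 (deriv f z)⁻¹) := by
    have := (continuousAt_dslope_same.2 hg.differentiableAt).tendsto
    rw [dslope_same, hg.deriv] at this
    exact this.comp hF
  have hlim : Tendsto (fun t => ((starRingEnd ℂ) z * (dslope g (f z) (F t) * Q t)).re) (𝓝[≠] 0)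
      (𝓝 ((starRingEnd ℂ) z * ((deriv f z)⁻¹ * D 0)).re) :=
    (Complex.continuous_re.tendsto _).comp
      (((hgc.mul hQ).const_mul _).mono_left nhdsWithin_le_nhds)
  have hnn : ∀ᶠ t : ℝ in 𝓝[≠] 0,
      0 ≤ ((starRingEnd ℂ) z * (dslope g (f z) (F t) * Q t)).re := by
    filter_upwards [self_mem_nhdsWithin] with t ht
    have hle : ‖g (F t)‖ ≤ ‖z‖ :=
      (hf.norm_invFunOn_le hz (a := Complex.exp (t * Complex.I))
        (b := Complex.exp (-(t * Complex.I))) (Complex.norm_exp_ofReal_mul_I t)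
        (by simpa using Complex.norm_exp_ofReal_mul_I (-t))).2
    have hs := sub_smul_dslope g (f z) (F t)
    rw [hFQ, hgz, smul_eq_mul] at hs
    -- `g (F t)` stays in the disk of radius `‖z‖`, so its displacement from `z` has no outward
    -- radial component. Dividing by `-t²` and letting `t → 0` gives the sign wanted.
    have hre : ((starRingEnd ℂ) z * (g (F t) - z)).re ≤ 0 := by
      have h1 : ((starRingEnd ℂ) z * g (F t)).re ≤ ‖z‖ * ‖z‖ := by
        refine (Complex.re_le_norm _).trans ?_
        rw [norm_mul, Complex.norm_conj]
        gcongr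
      have h2 : ((starRingEnd ℂ) z * z).re = ‖z‖ * ‖z‖ := by
        rw [mul_comm, Complex.mul_conj, Complex.normSq_eq_norm_sq, Complex.ofReal_re, sq]
      rw [mul_sub, Complex.sub_re, h2]; linarith
    have hre' : ((starRingEnd ℂ) z * (g (F t) - z)).re
        = -(t ^ 2 * ((starRingEnd ℂ) z * (dslope g (f z) (F t) * Q t)).re) := by
      rw [← hs, ← Complex.re_ofReal_mul, ← Complex.neg_re]
      congr 1; push_cast; ring
    have ht2 : 0 < t ^ 2 := sq_pos_of_ne_zero ht
    by_contra! hneg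
    nlinarith
  have h0 := ge_of_tendsto hlim hnn
  have hkey : (starRingEnd ℂ) z * ((deriv f z)⁻¹ * D 0)
      = ((‖z‖ ^ 2 / 2 : ℝ) : ℂ) * (1 + z * deriv (deriv f) z / deriv f z) := by
    have hzz : (starRingEnd ℂ) z * z = ((‖z‖ ^ 2 : ℝ) : ℂ) := by
      rw [mul_comm, Complex.mul_conj, Complex.normSq_eq_norm_sq]
    rw [hD0]
    push_cast at hzz ⊢
    rw [← hzz]
    field_simp
    ring
  rw [hkey, Complex.re_ofReal_mul] at h0
  have : 0 < ‖z‖ ^ 2 / 2 := by positivity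
  exact nonneg_of_mul_nonneg_right h0 this

/-- Trimble's inequality `3 |a₃ - a₂²| ≤ 1 - |a₂|²`. -/
theorem norm_coeff_le (hf : IsConvexUnivalent f) :
    ‖deriv (deriv (deriv f)) 0 / 2 - 3 * (deriv (deriv f) 0 / 2) ^ 2‖ ≤
      1 - ‖deriv (deriv f) 0 / 2‖ ^ 2 := by
  have hB : IsOpen (ball (0 : ℂ) 1) := isOpen_ball
  have hd1 : DifferentiableOn ℂ (deriv f) (ball 0 1) := hf.differentiableOn.deriv hB
  have hd2 : DifferentiableOn ℂ (deriv (deriv f)) (ball 0 1) := hd1.deriv hB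
  have key : ∀ z ∈ ball (0 : ℂ) 1, 2 * deriv f z + z * deriv (deriv f) z ≠ 0 ∧
      ‖z * deriv (deriv f) z‖ ≤ ‖2 * deriv f z + z * deriv (deriv f) z‖ := by
    intro z hz
    have hne := hf.deriv_ne_zero hz
    have hre := hf.re_one_add_nonneg hz
    set q := z * deriv (deriv f) z / deriv f z with hq
    have e1 : z * deriv (deriv f) z = deriv f z * q := by rw [hq]; field_simp
    have e2 : 2 * deriv f z + z * deriv (deriv f) z = deriv f z * (2 + q) := by rw [e1]; ring
    rw [e2, e1]
    simp only [Complex.add_re, Complex.one_re] at hre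
    refine ⟨mul_ne_zero hne fun h => ?_, ?_⟩
    · have := congrArg Complex.re h
      simp at this
      linarith
    · rw [norm_mul, norm_mul]
      gcongr
      rw [← sq_le_sq₀ (norm_nonneg _) (norm_nonneg _), ← Complex.normSq_eq_norm_sq,
        ← Complex.normSq_eq_norm_sq, Complex.normSq_apply, Complex.normSq_apply]
      simp
      nlinarith
  -- With `q = z f''/f'`, `z ψ` is `q / (2 + q)`, the Cayley transform of `1 + q`.
  set ψ : ℂ → ℂ := fun z => deriv (deriv f) z / (2 * deriv f z + z * deriv (deriv f) z) with hψ
  have hψd : DifferentiableOn ℂ ψ (ball 0 1) :=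
    hd2.div ((hd1.const_mul 2).add (differentiableOn_id.mul hd2)) fun z hz => (key z hz).1
  have hWd : DifferentiableOn ℂ (fun z => z * ψ z) (ball 0 1) := differentiableOn_id.mul hψd
  have hWm : MapsTo (fun z => z * ψ z) (ball 0 1) (closedBall ((fun z => z * ψ z) 0) 1) := by
    intro z hz
    simp only [zero_mul, mem_closedBall_zero_iff, hψ]
    rw [← mul_div_assoc, norm_div, div_le_one (norm_pos_iff.2 (key z hz).1)]
    exact (key z hz).2
  have h0 : (0 : ℂ) ∈ ball (0 : ℂ) 1 := mem_ball_self one_pos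
  have hψ0d := (hψd.differentiableAt (hB.mem_nhds h0)).hasDerivAt
  have hψm : MapsTo ψ (ball 0 1) (closedBall 0 1) := by
    intro z hz
    -- `ψ` is the divided slope of `z ψ z` at `0`, so the Schwarz lemma bounds it by `1`, including
    -- at `0`.
    have h := Complex.norm_dslope_le_div_of_mapsTo_ball hWd hWm hz
    rw [mem_closedBall_zero_iff]
    rcases eq_or_ne z 0 with rfl | hz0
    · rw [dslope_same, ((hasDerivAt_id' (0 : ℂ)).fun_mul hψ0d).deriv] at h
      simpa using h
    · rw [dslope_of_ne _ hz0, slope_def_field] at h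
      simpa [hz0] using h
  have hSP := norm_deriv_zero_le_one_sub_sq hψd hψm
  have hψ0 : ψ 0 = deriv (deriv f) 0 / 2 := by simp [hψ, hf.deriv_zero]
  have hg1 := (hd1.differentiableAt (hB.mem_nhds h0)).hasDerivAt
  have hg2 := (hd2.differentiableAt (hB.mem_nhds h0)).hasDerivAt
  have hψ' : deriv ψ 0 = deriv (deriv (deriv f)) 0 / 2 - 3 * (deriv (deriv f) 0 / 2) ^ 2 := by
    refine (hg2.fun_div ((hg1.const_mul 2).fun_add ((hasDerivAt_id' (0 : ℂ)).fun_mul hg2))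
      (key 0 h0).1).deriv.trans ?_
    simp [hf.deriv_zero]; ring
  rwa [hψ', hψ0] at hSP

theorem logCoeff_bounds (hf : IsConvexUnivalent f) :
    -(1 / Real.sqrt 10) ≤ ‖logCoeff f 2‖ - ‖logCoeff f 1‖ ∧
      ‖logCoeff f 2‖ - ‖logCoeff f 1‖ ≤ 1 / 6 := by
  have han : AnalyticAt ℂ f 0 :=
    hf.differentiableOn.analyticAt (isOpen_ball.mem_nhds (mem_ball_self one_pos))
  obtain ⟨h1, h2⟩ := logCoeff_one_two han hf.map_zero hf.deriv_zero
  have hT := hf.norm_coeff_le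
  rw [h1, h2]
  set a := deriv (deriv f) 0 / 2 with ha
  set d := deriv (deriv (deriv f)) 0 / 2 - 3 * a ^ 2 with hd
  have e1 : deriv (deriv f) 0 / 4 = a / 2 := by rw [ha]; ring
  have e2 : (deriv (deriv (deriv f)) 0 / 6 - a ^ 2 / 2) / 2 = d / 6 + a ^ 2 / 4 := by
    rw [hd]; ring
  rw [e1, e2]
  have n1 : ‖a / 2‖ = ‖a‖ / 2 := by simp
  have n2 : ‖a ^ 2 / 4‖ = ‖a‖ ^ 2 / 4 := by simp
  have n3 : ‖d / 6‖ = ‖d‖ / 6 := by simp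
  have hup := norm_add_le (d / 6) (a ^ 2 / 4)
  have hlow : ‖a ^ 2 / 4‖ - ‖d / 6‖ ≤ ‖d / 6 + a ^ 2 / 4‖ := by
    have := norm_sub_le (d / 6 + a ^ 2 / 4) (d / 6)
    rw [add_sub_cancel_left] at this
    linarith
  have h0 := norm_nonneg (d / 6 + a ^ 2 / 4)
  rw [n2, n3] at hup hlow
  rw [n1]
  have ht0 := norm_nonneg a
  have hd0 := norm_nonneg d
  have ht1 : ‖a‖ ≤ 1 := by nlinarith
  refine ⟨?_, by nlinarith⟩
  have hs : (1 / Real.sqrt 10) ^ 2 = 1 / 10 := by rw [div_pow, Real.sq_sqrt (by norm_num)]; norm_num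
  have hs0 : 0 < 1 / Real.sqrt 10 := by positivity
  set s := 1 / Real.sqrt 10 with hsdef
  -- `(5t² - 2)/12 - t/2` increases for `t ≥ 3/5`, and this puts `2s` in that range; its value at `t
  -- = 2s` is `-s`.
  have hs3 : 3 / 10 ≤ s := by nlinarith
  rcases le_total ‖a‖ (2 * s) with h | h
  · linarith
  · nlinarith [mul_nonneg (sub_nonneg.2 h) (sub_nonneg.2 hs3)]

end IsConvexUnivalent

/-! ### The extremal function `artanh`. -/

theorem re_one_add_div_one_sub_pos {z : ℂ} (hz : z ∈ ball (0 : ℂ) 1) :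
    1 + z ≠ 0 ∧ 1 - z ≠ 0 ∧ 0 < ((1 + z) / (1 - z)).re := by
  rw [mem_ball_zero_iff] at hz
  have h1 : 1 + z ≠ 0 := fun h => by
    rw [← neg_eq_of_add_eq_zero_right h] at hz; simp at hz
  have h2 : 1 - z ≠ 0 := fun h => by
    rw [← sub_eq_zero.1 h] at hz; simp at hz
  refine ⟨h1, h2, ?_⟩
  have hsq : Complex.normSq z < 1 := by
    rw [Complex.normSq_eq_norm_sq]; nlinarith [norm_nonneg z]
  rw [Complex.div_re, ← add_div]
  refine div_pos ?_ (Complex.normSq_pos.2 h2)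
  rw [Complex.normSq_apply] at hsq
  simp
  nlinarith

theorem hasDerivAt_log_div_two {z : ℂ} (hz : z ∈ ball (0 : ℂ) 1) :
    HasDerivAt (fun z => Complex.log ((1 + z) / (1 - z)) / 2) (1 / (1 - z ^ 2)) z := by
  obtain ⟨h1, h2, h3⟩ := re_one_add_div_one_sub_pos hz
  have h := ((((hasDerivAt_id' z).const_add 1).fun_div ((hasDerivAt_id' z).const_sub 1) h2).clog
    (Or.inl h3)).div_const 2
  refine h.congr_deriv ?_
  have : 1 - z ^ 2 = (1 + z) * (1 - z) := by ring
  rw [this]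
  field_simp
  ring

theorem convexExtremal_eq {z : ℂ} (hz : z ∈ ball (0 : ℂ) 1) :
    convexExtremal z = Complex.log ((1 + z) / (1 - z)) / 2 := by
  have hmem : ∀ s ∈ uIcc (0 : ℝ) 1, (s : ℂ) * z ∈ ball (0 : ℂ) 1 := by
    intro s hs
    rw [uIcc_of_le zero_le_one] at hs
    rw [mem_ball_zero_iff] at hz ⊢
    rw [norm_mul, Complex.norm_real, Real.norm_of_nonneg hs.1]
    nlinarith [hs.2, norm_nonneg z]
  have hder : ∀ s ∈ uIcc (0 : ℝ) 1,
      HasDerivAt (fun s : ℝ => Complex.log ((1 + (s : ℂ) * z) / (1 - (s : ℂ) * z)) / 2)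
        (z / (1 - ((s : ℂ) * z) ^ 2)) s := by
    intro s hs
    have h := (hasDerivAt_log_div_two (hmem s hs)).comp (s : ℂ) ((hasDerivAt_id' (s : ℂ)).mul_const z)
    exact h.comp_ofReal.congr_deriv (by ring)
  have hcont : ContinuousOn (fun s : ℝ => z / (1 - ((s : ℂ) * z) ^ 2)) (uIcc 0 1) := by
    refine continuousOn_const.div (by fun_prop) fun s hs => ?_
    obtain ⟨h1, h2, -⟩ := re_one_add_div_one_sub_pos (hmem s hs)
    have : 1 - ((s : ℂ) * z) ^ 2 = (1 + s * z) * (1 - s * z) := by ring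
    rw [this]; exact mul_ne_zero h1 h2
  rw [convexExtremal, intervalIntegral.integral_eq_sub_of_hasDerivAt hder
    hcont.intervalIntegrable]
  simp

theorem hasDerivAt_convexExtremal {z : ℂ} (hz : z ∈ ball (0 : ℂ) 1) :
    HasDerivAt convexExtremal (1 / (1 - z ^ 2)) z := by
  refine (hasDerivAt_log_div_two hz).congr_of_eventuallyEq ?_
  filter_upwards [isOpen_ball.mem_nhds hz] with w hw using convexExtremal_eq hw

/-- The extremal function maps the unit disk onto a horizontal strip. -/
theorem convexExtremal_image :
    convexExtremal '' ball 0 1 = {w : ℂ | -(Real.pi / 4) < w.im} ∩ {w : ℂ | w.im < Real.pi / 4} := by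
  ext w
  constructor
  · rintro ⟨z, hz, rfl⟩
    obtain ⟨-, -, h3⟩ := re_one_add_div_one_sub_pos hz
    have := abs_lt.1 (Complex.abs_arg_lt_pi_div_two_iff.2 (Or.inl h3))
    have e : (Complex.log ((1 + z) / (1 - z)) / 2).im = ((1 + z) / (1 - z)).arg / 2 := by
      rw [Complex.div_ofNat_im, Complex.log_im]
    simp only [mem_inter_iff, mem_ofPred_eq]
    rw [convexExtremal_eq hz, e]
    constructor <;> linarith [this.1, this.2]
  · rintro ⟨h1, h2⟩
    simp only [mem_ofPred_eq] at h1 h2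
    -- Since `|Im 2w| < π/2`, `ζ` lies in the right half-plane, and its Cayley transform `(ζ - 1) /
    -- (ζ + 1)` is the preimage of `w`.
    set ζ := Complex.exp (2 * w) with hζ
    have him : (2 * w).im = 2 * w.im := by simp
    have hre : 0 < ζ.re := by
      rw [hζ, Complex.exp_re, him]
      exact mul_pos (Real.exp_pos _) (Real.cos_pos_of_mem_Ioo ⟨by linarith, by linarith⟩)
    have hne : ζ + 1 ≠ 0 := fun h => by
      have := congrArg Complex.re h
      simp at this; linarith
    have hz : (ζ - 1) / (ζ + 1) ∈ ball (0 : ℂ) 1 := by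
      rw [mem_ball_zero_iff, norm_div, div_lt_one (norm_pos_iff.2 hne),
        ← sq_lt_sq₀ (norm_nonneg _) (norm_nonneg _), ← Complex.normSq_eq_norm_sq,
        ← Complex.normSq_eq_norm_sq, Complex.normSq_apply, Complex.normSq_apply]
      simp
      nlinarith
    refine ⟨_, hz, ?_⟩
    have e : (1 + (ζ - 1) / (ζ + 1)) / (1 - (ζ - 1) / (ζ + 1)) = ζ := by
      have : 1 - (ζ - 1) / (ζ + 1) = 2 / (ζ + 1) := by field_simp; ring
      rw [this]; field_simp; ring
    rw [convexExtremal_eq hz, e, hζ, Complex.log_exp (by rw [him]; linarith [Real.pi_pos])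
      (by rw [him]; linarith [Real.pi_pos])]
    ring

theorem isConvexUnivalent_convexExtremal : IsConvexUnivalent convexExtremal where
  differentiableOn z hz := (hasDerivAt_convexExtremal hz).differentiableAt.differentiableWithinAt
  map_zero := by simp [convexExtremal]
  deriv_zero := by simpa using (hasDerivAt_convexExtremal (mem_ball_self one_pos)).deriv
  injOn := by
    intro z hz w hw h
    obtain ⟨hz1, hz2, -⟩ := re_one_add_div_one_sub_pos hz
    obtain ⟨hw1, hw2, -⟩ := re_one_add_div_one_sub_pos hw
    rw [convexExtremal_eq hz, convexExtremal_eq hw, div_left_inj' two_ne_zero] at h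
    have := congrArg Complex.exp h
    rw [Complex.exp_log (div_ne_zero hz1 hz2), Complex.exp_log (div_ne_zero hw1 hw2),
      div_eq_div_iff hz2 hw2] at this
    linear_combination this / 2
  convex_image := by
    rw [convexExtremal_image]
    exact (convex_halfSpace_im_gt _).inter (convex_halfSpace_im_lt _)

theorem logCoeff_convexExtremal :
    logCoeff convexExtremal 1 = 0 ∧ logCoeff convexExtremal 2 = 1 / 6 := by
  have hB : IsOpen (ball (0 : ℂ) 1) := isOpen_ball
  have h0 : (0 : ℂ) ∈ ball (0 : ℂ) 1 := mem_ball_self one_pos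
  have hc := isConvexUnivalent_convexExtremal
  have hne : ∀ z ∈ ball (0 : ℂ) 1, 1 - z ^ 2 ≠ 0 := by
    intro z hz
    obtain ⟨h1, h2, -⟩ := re_one_add_div_one_sub_pos hz
    have : 1 - z ^ 2 = (1 + z) * (1 - z) := by ring
    rw [this]; exact mul_ne_zero h1 h2
  have hpow : ∀ z : ℂ, HasDerivAt (fun z : ℂ => 1 - z ^ 2) (-(2 * z)) z := fun z => by
    simpa using (hasDerivAt_pow 2 z).const_sub 1
  have e1 : deriv convexExtremal =ᶠ[𝓝 0] fun z => 1 / (1 - z ^ 2) := by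
    filter_upwards [hB.mem_nhds h0] with z hz using (hasDerivAt_convexExtremal hz).deriv
  have e2 : deriv (deriv convexExtremal) =ᶠ[𝓝 0] fun z => 2 * z / (1 - z ^ 2) ^ 2 := by
    filter_upwards [e1.eventuallyEq_nhds, hB.mem_nhds h0] with z hz hz'
    rw [hz.deriv_eq]
    refine ((hasDerivAt_const z (1 : ℂ)).fun_div (hpow z) (hne z hz')).deriv.trans ?_
    ring
  have e3 : deriv (deriv (deriv convexExtremal)) 0 = 2 := by
    rw [e2.deriv_eq]
    refine (((hasDerivAt_id' (0 : ℂ)).const_mul 2).fun_div ((hpow 0).fun_pow 2)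
      (by simp)).deriv.trans ?_
    simp
  have e2' := e2.self_of_nhds
  simp only [mul_zero, zero_div] at e2'
  obtain ⟨h1, h2⟩ := logCoeff_one_two (hc.differentiableOn.analyticAt (hB.mem_nhds h0))
    hc.map_zero hc.deriv_zero
  rw [h1, h2, e2', e3]
  norm_num

theorem mainTheorem2 :
    (∀ f : ℂ → ℂ, IsConvexUnivalent f →
      -(1 / Real.sqrt 10) ≤ ‖logCoeff f 2‖ - ‖logCoeff f 1‖ ∧
        ‖logCoeff f 2‖ - ‖logCoeff f 1‖ ≤ 1 / 6) ∧
    IsConvexUnivalent convexExtremal ∧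
    (∀ z ∈ Metric.ball (0 : ℂ) 1,
      convexExtremal z = Complex.log ((1 + z) / (1 - z)) / 2) ∧
    ‖logCoeff convexExtremal 2‖ - ‖logCoeff convexExtremal 1‖ = 1 / 6 :=
  ⟨fun _ hf => hf.logCoeff_bounds, isConvexUnivalent_convexExtremal,
    fun _ hz => convexExtremal_eq hz, by
      rw [logCoeff_convexExtremal.1, logCoeff_convexExtremal.2]; norm_num⟩
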